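/- For $n\ge 0$ let $\mathcal B_n$ be the poset of all subsets of $[n]=\{1,\dots,n\}$ ordered by inclusion, and let $P$ be a finite nonempty poset. A weak embedding of $P$ into $\mathcal B_n$ is an injective map $f:P\to\mathcal B_n$ such that $a<b$ in $P$ implies $f(a)\subsetneq f(b)$; its image $f(P)$ is called a copy of $P$ in $\mathcal B_n$. Copies $\mathcal F_i$ of $P$ are pairwise unrelated if, for all $i\ne j$, $A\in\mathcal F_i$ and $B\in\mathcal F_j$, neither $A\subseteq B$ nor $B\subseteq A$. Let $\mathrm{pa}(n,P)$ be the maximum of $\left|\bigcup_i\mathcal F_i\right|$ over all collections $\{\mathcal F_i\}$ of pairwise unrelated copies of $P$ in $\mathcal B_n$ (the empty collection is allowed). For $\mathcal F\subseteq\mathcal B_k$, the convex closure of $\mathcal F$ is $$\overline{\mathcal F}=\{S\in\mathcal B_k : A\subseteq S\subseteq B\text{ for some }A,B\in\mathcal F\},$$ and let $c(P)$ be the minimum of $\left|\overline{f(P)}\right|$ over all $k\ge 0$ and all weak embeddings $f$ of $P$ into $\mathcal B_k$. **Theorem.** For every finite nonempty poset $P$, $$\mathrm{pa}(n,P)\sim\frac{|P|}{c(P)}\binom{n}{\lfloor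 n/2\rfloor}\qquad\text{as } n\to\infty .$$ -/

import Mathlib

open Filter Asymptotics

namespace PosetPacking

/-- A weak embedding of the poset `P` into the Boolean lattice of all subsets of an
`n`-element set: an injective map with `a < b → f a ⊂ f b`. -/
structure IsWeakEmbedding {P : Type*} [PartialOrder P] {n : ℕ} (f : P → Finset (Fin n)) :
    Prop where
  injective : Function.Injective f
  ssubset_of_lt : ∀ a b : P, a < b → f a ⊂ f b

/-- `F` is a (weak) copy of `P`, i.e. the image of a weak embedding. -/
def IsCopy (P : Type*) [PartialOrder P] [Fintype P] {n : ℕ}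
    (F : Finset (Finset (Fin n))) : Prop :=
  ∃ f : P → Finset (Fin n), IsWeakEmbedding f ∧ F = Finset.univ.image f

/-- Two families of sets are unrelated if no member of one contains, or is contained in,
a member of the other (equal sets are related). -/
def Unrelated {n : ℕ} (F G : Finset (Finset (Fin n))) : Prop :=
  ∀ A ∈ F, ∀ B ∈ G, ¬ A ⊆ B ∧ ¬ B ⊆ A

/-- `F` is the union of a collection of pairwise unrelated copies of `P`. -/
def IsPacking (P : Type*) [PartialOrder P] [Fintype P] {n : ℕ}
    (F : Finset (Finset (Fin n))) : Prop :=
  ∃ C : Finset (Finset (Finset (Fin n))),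
    (∀ G ∈ C, IsCopy P G) ∧ (∀ G ∈ C, ∀ H ∈ C, G ≠ H → Unrelated G H) ∧ F = C.biUnion id

/-- The maximum size of a family in the Boolean lattice on `n` elements which is the union of
pairwise unrelated copies of `P`. -/
noncomputable def pa (n : ℕ) (P : Type*) [PartialOrder P] [Fintype P] : ℕ :=
  sSup {s : ℕ | ∃ F : Finset (Finset (Fin n)), IsPacking P F ∧ F.card = s}

/-- The convex closure of a family of sets. -/
def convexClosure {n : ℕ} (F : Finset (Finset (Fin n))) : Finset (Finset (Fin n)) :=
  Finset.univ.filter fun S => ∃ A ∈ F, ∃ B ∈ F, A ⊆ S ∧ S ⊆ B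

/-- The minimum, over all `k` and all weak embeddings `f` of `P` into the Boolean lattice on `k`
elements, of the size of the convex closure of `f(P)`. -/
noncomputable def c (P : Type*) [PartialOrder P] [Fintype P] : ℕ :=
  sInf {m : ℕ | ∃ (k : ℕ) (f : P → Finset (Fin k)),
    IsWeakEmbedding f ∧ (convexClosure (Finset.univ.image f)).card = m}

/-- The supremum defining `pa` is a maximum. -/
theorem pa_isGreatest (n : ℕ) (P : Type*) [PartialOrder P] [Fintype P] :
    IsGreatest {s : ℕ | ∃ F : Finset (Finset (Fin n)), IsPacking P F ∧ F.card = s} (pa n P) := by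
  have hb : BddAbove {s : ℕ | ∃ F : Finset (Finset (Fin n)), IsPacking P F ∧ F.card = s} := by
    refine ⟨Fintype.card (Finset (Fin n)), ?_⟩
    rintro s ⟨F, -, rfl⟩
    exact F.card_le_univ
  have hne : {s : ℕ | ∃ F : Finset (Finset (Fin n)), IsPacking P F ∧ F.card = s}.Nonempty :=
    ⟨0, ∅, ⟨∅, by simp, by simp, by simp⟩, by simp⟩
  exact ⟨Nat.sSup_mem hne hb, fun s hs => le_csSup hb hs⟩

/-- The infimum defining `c` is a minimum. -/
theorem c_isLeast (P : Type*) [PartialOrder P] [Fintype P] :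
    IsLeast {m : ℕ | ∃ (k : ℕ) (f : P → Finset (Fin k)),
      IsWeakEmbedding f ∧ (convexClosure (Finset.univ.image f)).card = m} (c P) := by
  classical
  refine ⟨Nat.sInf_mem ?_, fun m hm => Nat.sInf_le hm⟩
  let f : P → Finset (Fin (Fintype.card P)) := fun a =>
    Finset.univ.filter fun i => (Fintype.equivFin P).symm i ≤ a
  have hsub : ∀ a b : P, f a ⊆ f b → a ≤ b := by
    intro a b h
    have := @h (Fintype.equivFin P a) (by simp [f])
    simpa [f] using this
  have hmono : ∀ a b : P, a ≤ b → f a ⊆ f b := by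
    intro a b h i hi
    simp only [f, Finset.mem_filter, Finset.mem_univ, true_and] at hi ⊢
    exact hi.trans h
  exact ⟨_, _, f, ⟨fun a b h => le_antisymm (hsub _ _ h.subset) (hsub _ _ h.symm.subset),
    fun a b h => ⟨hmono _ _ h.le, fun h' => h.not_ge (hsub _ _ h')⟩⟩, rfl⟩

end PosetPacking

/-!
Copies of `P` are packed with density `1 / c P` relative to the middle level of the Boolean lattice.

Upper bound. Pairwise unrelated copies have pairwise unrelated convex closures, each with at least
`c P` members, and a full chain meets at most one of them. Full chains are encoded as numberings of
the ground set, a chain through `A` being a numbering with prefix `A`. A set lies on at least a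
fraction `1 / n.choose (n / 2)` of all chains, and two different sets other than `∅` and the ground
set share few chains (`mul_card_prefixed_inter_le`), so `c P` such sets meet a fraction of about
`c P / n.choose (n / 2)` of the chains. Hence there are at most about `n.choose (n / 2) / c P`
copies (`card_mul_le_of_unrelated`, `eventually_pa_div_le`).

Lower bound. Let `f` embed `P` into the subsets of `Fin k` with a convex closure `Q` of size `c P`.
Split the ground set into `k` and `m` elements. The sets `f p ∪ A`, with `A` running over one level
on the last `m` elements, give unrelated copies of `P`. They use only the traces in `Q` on the first
`k` elements, and above each of the `2 ^ k - c P` other traces the construction is repeated on the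
`m` elements. Since `Q` is convex, there is a function on the traces that is strictly decreasing
along inclusion except that it is constant on `Q` (`height_lt_height`). Choosing the levels of the
remainders according to it makes the parts unrelated (`hasPacking_add`). If the density `β` is
attainable then so is `((2 ^ k - c P) * β + 1) / 2 ^ k` (`AsymptoticPacking.step`), and the iterates
of this map converge to its fixed point `1 / c P`.
-/

namespace PosetPacking

open Finset Numbering

/-! ### Full chains through the members of a family -/

/-- Numberings with prefixes `A ⊆ B` amount to numberings of `A`, of `B \ A` and of the complement
of `B`; only the upper bound on their number is needed. -/
theorem card_prefixed_inter_le {X : Type*} [Fintype X] [DecidableEq X] {A B : Finset X}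
    (h : A ⊆ B) :
    (prefixed A ∩ prefixed B).card ≤
      A.card.factorial * (B.card - A.card).factorial * (Fintype.card X - B.card).factorial := by
  have key : (prefixed A ∩ prefixed B).card ≤
      ((prefixed (A.subtype (· ∈ B))) ×ˢ (univ : Finset (Numbering ↑(Bᶜ)))).card := by
    refine card_le_card_of_injOn
      (fun f => if hf : f ∈ prefixed B then prefixedEquiv B ⟨f, hf⟩ else
        (Fintype.equivFin _, Fintype.equivFin _)) ?_ ?_
    · intro f hf
      simp only [coe_inter, Set.mem_inter_iff, mem_coe] at hf
      simp only [hf.2, dif_pos, coe_product, Set.mem_prod, mem_coe, mem_univ, and_true,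
        mem_prefixed]
      intro x
      have h1 := (mem_prefixed.1 hf.1) x.1
      have h2 : (A.subtype (· ∈ B)).card = A.card := by
        rw [Finset.card_subtype, filter_true_of_mem (fun x hx => h hx)]
      rw [mem_subtype, h1, h2]
      rfl
    · intro f hf g hg hfg
      simp only [coe_inter, Set.mem_inter_iff, mem_coe] at hf hg
      simp only [hf.2, hg.2, dif_pos] at hfg
      simpa using hfg
  refine key.trans (le_of_eq ?_)
  rw [card_product, card_prefixed, Finset.card_subtype, filter_true_of_mem (fun x hx => h hx),
    card_univ, Fintype.card_numbering]
  simp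

theorem le_choose {b a : ℕ} (ha : 0 < a) (hab : a < b) : b ≤ b.choose a := by
  obtain ⟨b, rfl⟩ : ∃ b', b = b' + 1 := ⟨b - 1, by omega⟩
  induction b generalizing a with
  | zero => omega
  | succ b ih =>
    obtain ⟨a, rfl⟩ : ∃ a', a = a' + 1 := ⟨a - 1, by omega⟩
    rw [Nat.choose_succ_succ]
    rcases Nat.lt_or_ge (a + 1) (b + 1) with h | h
    · have := ih (a := a + 1) (by omega) h
      have := Nat.choose_pos (n := b + 1) (k := a) (by omega)
      simp only [Nat.succ_eq_add_one] at *
      omega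
    · have : a = b := by omega
      subst this
      simp

theorem mul_factorial_le {b a : ℕ} (ha : 0 < a) (hab : a < b) :
    b * (a.factorial * (b - a).factorial) ≤ b.factorial := by
  rw [← Nat.choose_mul_factorial_mul_factorial hab.le, mul_assoc]
  exact Nat.mul_le_mul_right _ (le_choose ha hab)

theorem mul_card_prefixed_inter_le_of_ssubset {X : Type*} [Fintype X] [DecidableEq X]
    {A B : Finset X} (h : A ⊂ B) (hA : A.Nonempty) (hB : B ≠ univ) :
    Fintype.card X * (prefixed A ∩ prefixed B).card ≤
      2 * ((prefixed A).card + (prefixed B).card) := by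
  have h0 := card_prefixed_inter_le h.subset
  have ha : 0 < A.card := hA.card_pos
  have hab : A.card < B.card := card_lt_card h
  have hb : B.card < Fintype.card X :=
    lt_of_le_of_ne B.card_le_univ fun h' => hB ((card_eq_iff_eq_univ B).1 h')
  rw [card_prefixed, card_prefixed]
  generalize (prefixed A ∩ prefixed B).card = x at *
  generalize A.card = a at *
  generalize B.card = b at *
  generalize Fintype.card X = n at *
  -- Whichever of `B` and the complement of `A` has at least `n / 2` elements leaves at least
  -- `n / 2` choices for the other set.
  rcases le_total n (2 * b) with hn | hn
  · calc n * x ≤ (2 * b) * (a.factorial * (b - a).factorial * (n - b).factorial) :=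
        Nat.mul_le_mul hn h0
      _ = 2 * ((b * (a.factorial * (b - a).factorial)) * (n - b).factorial) := by ring
      _ ≤ 2 * (b.factorial * (n - b).factorial) := by
        gcongr; exact mul_factorial_le ha hab
      _ ≤ _ := by gcongr; exact Nat.le_add_left _ _
  · have := mul_factorial_le (b := n - a) (a := b - a) (by omega) (by omega)
    rw [show n - a - (b - a) = n - b by omega] at this
    calc n * x ≤ (2 * (n - a)) * (a.factorial * (b - a).factorial * (n - b).factorial) :=
        Nat.mul_le_mul (by omega) h0
      _ = 2 * (a.factorial * ((n - a) * ((b - a).factorial * (n - b).factorial))) := by ring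
      _ ≤ 2 * (a.factorial * (n - a).factorial) := by gcongr
      _ ≤ _ := by gcongr; exact Nat.le_add_right _ _

/-- Two different nontrivial sets lie on few common chains, compared to the chains through at least
one of them. -/
theorem mul_card_prefixed_inter_le {X : Type*} [Fintype X] [DecidableEq X]
    {A B : Finset X} (h : A ≠ B) (hA : A ≠ ∅) (hA' : A ≠ univ) (hB : B ≠ ∅) (hB' : B ≠ univ) :
    Fintype.card X * (prefixed A ∩ prefixed B).card ≤
      2 * ((prefixed A).card + (prefixed B).card) := by
  by_cases h1 : A ⊆ B
  · exact mul_card_prefixed_inter_le_of_ssubset (h1.ssubset_of_ne h)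
      (nonempty_iff_ne_empty.2 hA) hB'
  by_cases h2 : B ⊆ A
  · rw [inter_comm, add_comm]
    exact mul_card_prefixed_inter_le_of_ssubset (h2.ssubset_of_ne h.symm)
      (nonempty_iff_ne_empty.2 hB) hA'
  · simp [disjoint_iff_inter_eq_empty.1 (disjoint_prefixed_prefixed h1 h2)]

/-- A Bonferroni-type inequality: the points covered exactly once are at least the total
covering minus the pairwise overlaps. -/
theorem sum_card_le_card_biUnion_add {α β : Type*} [DecidableEq α] [DecidableEq β]
    (G : Finset α) (p : α → Finset β) :
    ∑ A ∈ G, (p A).card ≤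
      (G.biUnion p).card + ∑ A ∈ G, ∑ B ∈ G.erase A, (p A ∩ p B).card := by
  have h1 : ∀ A ∈ G, (p A).card ≤
      (p A \ (G.erase A).biUnion p).card + ∑ B ∈ G.erase A, (p A ∩ p B).card := by
    intro A _
    rw [← card_sdiff_add_card_inter (p A) ((G.erase A).biUnion p)]
    gcongr
    rw [inter_biUnion]
    exact card_biUnion_le
  refine (sum_le_sum h1).trans ?_
  rw [sum_add_distrib, ← card_biUnion]
  · gcongr
    exact biUnion_mono fun A _ => sdiff_subset
  · intro A hA B hB hAB
    refine disjoint_left.2 fun x hx hx' => ?_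
    exact (mem_sdiff.1 hx).2
      (mem_biUnion.2 ⟨B, mem_erase.2 ⟨hAB.symm, hB⟩, (mem_sdiff.1 hx').1⟩)

/-- For a family `G` of nontrivial sets, the number of chains meeting `G` is at least
`1 - 4 * #G / #X` times the sum of the numbers of chains through its members. -/
theorem mul_sum_card_prefixed_le {X : Type*} [Fintype X] [DecidableEq X] (G : Finset (Finset X))
    (h0 : ∅ ∉ G) (h1 : univ ∉ G) :
    Fintype.card X * ∑ A ∈ G, (prefixed A).card ≤
      Fintype.card X * (G.biUnion prefixed).card + 4 * G.card * ∑ A ∈ G, (prefixed A).card := by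
  have hne : ∀ A ∈ G, A ≠ ∅ ∧ A ≠ univ := fun A hA =>
    ⟨fun h => h0 (h ▸ hA), fun h => h1 (h ▸ hA)⟩
  refine (Nat.mul_le_mul_left _ (sum_card_le_card_biUnion_add G prefixed)).trans ?_
  rw [mul_add]
  refine Nat.add_le_add_left ?_ _
  calc Fintype.card X * ∑ A ∈ G, ∑ B ∈ G.erase A, (prefixed A ∩ prefixed B).card
      = ∑ A ∈ G, ∑ B ∈ G.erase A, Fintype.card X * (prefixed A ∩ prefixed B).card := by
        simp_rw [mul_sum]
    _ ≤ ∑ A ∈ G, ∑ B ∈ G.erase A, 2 * ((prefixed A).card + (prefixed B).card) := by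
        refine sum_le_sum fun A hA => sum_le_sum fun B hB => ?_
        rw [mem_erase] at hB
        exact mul_card_prefixed_inter_le hB.1.symm (hne A hA).1 (hne A hA).2 (hne B hB.2).1
          (hne B hB.2).2
    _ ≤ ∑ A ∈ G, ∑ B ∈ G, 2 * ((prefixed A).card + (prefixed B).card) :=
        sum_le_sum fun A _ => sum_le_sum_of_subset (erase_subset _ _)
    _ = 4 * G.card * ∑ A ∈ G, (prefixed A).card := by
        simp only [← mul_sum, sum_add_distrib, sum_const, smul_eq_mul]
        ring

theorem factorial_le_card_prefixed_mul {n : ℕ} (A : Finset (Fin n)) :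
    n.factorial ≤ (prefixed A).card * n.choose (n / 2) := by
  have hA : A.card ≤ n := by simpa using A.card_le_univ
  rw [card_prefixed, Fintype.card_fin, ← Nat.choose_mul_factorial_mul_factorial hA, mul_assoc,
    mul_comm]
  exact Nat.mul_le_mul_left _ (Nat.choose_le_middle _ _)

/-- Unrelated families meet disjoint sets of full chains. -/
theorem Unrelated.disjoint_biUnion_prefixed {n : ℕ} {F G : Finset (Finset (Fin n))}
    (h : Unrelated F G) : Disjoint (F.biUnion prefixed) (G.biUnion prefixed) := by
  simp only [disjoint_biUnion_left, disjoint_biUnion_right]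
  exact fun B hB A hA => disjoint_prefixed_prefixed (h A hA B hB).1 (h A hA B hB).2

/-- Since unrelated families meet disjoint sets of full chains, few families of size `c` can be
pairwise unrelated: asymptotically at most `1 / c` times the size of the middle level. -/
theorem card_mul_le_of_unrelated {n c : ℕ} {ι : Type*} (s : Finset ι)
    (G : ι → Finset (Finset (Fin n))) (hc : ∀ i ∈ s, (G i).card = c)
    (h0 : ∀ i ∈ s, ∅ ∉ G i) (h1 : ∀ i ∈ s, univ ∉ G i)
    (hG : ∀ i ∈ s, ∀ j ∈ s, i ≠ j → Unrelated (G i) (G j)) :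
    s.card * c * (n - 4 * c) ≤ n * n.choose (n / 2) := by
  have hU : ∑ i ∈ s, ((G i).biUnion prefixed).card ≤ n.factorial := by
    rw [← card_biUnion fun i hi j hj hij => (hG i hi j hj hij).disjoint_biUnion_prefixed]
    refine (card_le_univ _).trans_eq ?_
    simp
  have hi : ∀ i ∈ s, (n - 4 * c) * (c * n.factorial) ≤
      n * n.choose (n / 2) * ((G i).biUnion prefixed).card := by
    intro i hi
    have hsum : c * n.factorial ≤ (∑ A ∈ G i, (prefixed A).card) * n.choose (n / 2) := by
      rw [sum_mul, ← hc i hi, ← smul_eq_mul, ← sum_const]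
      exact sum_le_sum fun A _ => factorial_le_card_prefixed_mul A
    have h2 := mul_sum_card_prefixed_le (G i) (h0 i hi) (h1 i hi)
    simp only [hc i hi, Fintype.card_fin] at h2
    calc (n - 4 * c) * (c * n.factorial)
        ≤ (n - 4 * c) * ((∑ A ∈ G i, (prefixed A).card) * n.choose (n / 2)) := by gcongr
      _ = ((n - 4 * c) * ∑ A ∈ G i, (prefixed A).card) * n.choose (n / 2) := by ring
      _ ≤ (n * ((G i).biUnion prefixed).card) * n.choose (n / 2) := by
        refine Nat.mul_le_mul_right _ ?_
        rw [Nat.sub_mul]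
        omega
      _ = _ := by ring
  have h3 := sum_le_sum hi
  rw [sum_const, smul_eq_mul, ← mul_sum] at h3
  have h4 := h3.trans (Nat.mul_le_mul_left _ hU)
  refine Nat.le_of_mul_le_mul_right ?_ n.factorial_pos
  calc _ = s.card * ((n - 4 * c) * (c * n.factorial)) := by ring
    _ ≤ _ := h4

/-! ### The upper bound -/

theorem subset_convexClosure {n : ℕ} (F : Finset (Finset (Fin n))) : F ⊆ convexClosure F := by
  intro A hA
  simp only [convexClosure, mem_filter, mem_univ, true_and]
  exact ⟨A, hA, A, hA, Subset.rfl, Subset.rfl⟩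

/-- Unrelated families have unrelated convex closures, which is why `c P` rather than the number of
elements of `P` counts in the upper bound. -/
theorem Unrelated.convexClosure {n : ℕ} {F G : Finset (Finset (Fin n))} (h : Unrelated F G) :
    Unrelated (convexClosure F) (convexClosure G) := by
  intro S hS T hT
  simp only [PosetPacking.convexClosure, mem_filter, mem_univ, true_and] at hS hT
  obtain ⟨A, hA, B, hB, hAS, hSB⟩ := hS
  obtain ⟨A', hA', B', hB', hAT, hTB⟩ := hT
  exact ⟨fun h' => (h A hA B' hB').1 (hAS.trans (h'.trans hTB)),
    fun h' => (h B hB A' hA').2 (hAT.trans (h'.trans hSB))⟩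

section UpperBound

variable {P : Type*} [PartialOrder P] [Fintype P]

theorem IsCopy.card_eq {n : ℕ} {F : Finset (Finset (Fin n))} (h : IsCopy P F) :
    F.card = Fintype.card P := by
  obtain ⟨f, hf, rfl⟩ := h
  rw [card_image_of_injective _ hf.injective, card_univ]

theorem IsCopy.c_le {n : ℕ} {F : Finset (Finset (Fin n))} (h : IsCopy P F) :
    c P ≤ (convexClosure F).card := by
  obtain ⟨f, hf, rfl⟩ := h
  exact (c_isLeast P).2 ⟨n, f, hf, rfl⟩

theorem IsCopy.nonempty [Nonempty P] {n : ℕ} {F : Finset (Finset (Fin n))} (h : IsCopy P F) :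
    F.Nonempty := by
  rw [← card_pos, h.card_eq]
  exact Fintype.card_pos

/-- With two copies present, no convex closure contains the empty or the full set, which are related
to every set, so the chain count applies to subfamilies of size `c P` of the convex closures. -/
theorem card_mul_c_mul_le [Nonempty P] {n : ℕ} {C : Finset (Finset (Finset (Fin n)))}
    (hC : ∀ G ∈ C, IsCopy P G) (hU : ∀ G ∈ C, ∀ H ∈ C, G ≠ H → Unrelated G H)
    (h2 : 2 ≤ C.card) :
    C.card * c P * (n - 4 * c P) ≤ n * n.choose (n / 2) := by
  have hex : ∀ G : C, ∃ G' ⊆ convexClosure G.1, G'.card = c P := fun G =>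
    exists_subset_card_eq (hC G G.2).c_le
  choose G' hsub hcard using hex
  have hne : ∀ G : C, ∃ H : C, G ≠ H := by
    intro G
    obtain ⟨H, hH, hHG⟩ := exists_mem_ne (one_lt_two.trans_le h2) G.1
    exact ⟨⟨H, hH⟩, fun h => hHG (congrArg Subtype.val h).symm⟩
  have hUn : ∀ G H : C, G ≠ H → Unrelated (convexClosure G.1) (convexClosure H.1) :=
    fun G H hGH => (hU G G.2 H H.2 fun h => hGH (Subtype.ext h)).convexClosure
  have := card_mul_le_of_unrelated (univ : Finset C) G' (fun G _ => hcard G)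
    (fun G _ h => by
      obtain ⟨H, hGH⟩ := hne G
      obtain ⟨B, hB⟩ := (hC H H.2).nonempty
      exact (hUn G H hGH _ (hsub G h) B (subset_convexClosure _ hB)).1 (empty_subset _))
    (fun G _ h => by
      obtain ⟨H, hGH⟩ := hne G
      obtain ⟨B, hB⟩ := (hC H H.2).nonempty
      exact (hUn G H hGH _ (hsub G h) B (subset_convexClosure _ hB)).2 (subset_univ _))
    (fun G _ H _ hGH A hA B hB => hUn G H hGH A (hsub G hA) B (hsub H hB))
  simpa using this

theorem exists_pa_le [Nonempty P] (n : ℕ) :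
    ∃ m : ℕ, pa n P ≤ m * Fintype.card P ∧
      (2 ≤ m → m * c P * (n - 4 * c P) ≤ n * n.choose (n / 2)) := by
  obtain ⟨F, ⟨C, hC, hU, rfl⟩, hF⟩ := (pa_isGreatest n P).1
  refine ⟨C.card, ?_, card_mul_c_mul_le hC hU⟩
  rw [← hF]
  exact card_biUnion_le_card_mul _ _ _ fun G hG => (hC G hG).card_eq.le

end UpperBound

/-! ### Binomial coefficients near the middle -/

/-- Levels at bounded distance from the middle are asymptotically as large as the middle one. -/
theorem tendsto_choose_add_div_choose (s : ℕ) :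
    Tendsto (fun n : ℕ => (n.choose (n / 2 + s) : ℝ) / n.choose (n / 2)) atTop (nhds 1) := by
  induction s with
  | zero =>
    refine tendsto_const_nhds.congr fun n => ?_
    have : (n.choose (n / 2) : ℝ) ≠ 0 := by
      exact_mod_cast (Nat.choose_pos (Nat.div_le_self n 2)).ne'
    simp [this]
  | succ s ih =>
    have hd : Tendsto (fun n : ℕ => ((n / 2 : ℕ) : ℝ) + s + 1) atTop atTop := by
      refine tendsto_atTop_add_const_right _ _ (tendsto_atTop_add_const_right _ _ ?_)
      exact tendsto_natCast_atTop_atTop.comp (Nat.tendsto_div_const_atTop two_ne_zero)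
    have hz : Tendsto (fun n : ℕ => 1 - (2 * s + 1 : ℝ) / (((n / 2 : ℕ) : ℝ) + s + 1)) atTop
        (nhds 1) := by
      simpa using tendsto_const_nhds.sub (hd.const_div_atTop (2 * s + 1 : ℝ))
    have hq : Tendsto (fun n : ℕ => ((n : ℝ) - ((n / 2 : ℕ) : ℝ) - s) /
        (((n / 2 : ℕ) : ℝ) + s + 1)) atTop (nhds 1) := by
      refine tendsto_of_tendsto_of_tendsto_of_le_of_le hz tendsto_const_nhds ?_ ?_
      · intro n
        have h1 : (2 * ((n / 2 : ℕ) : ℝ)) ≤ n := by exact_mod_cast Nat.mul_div_le n 2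
        have hp : (0 : ℝ) < ((n / 2 : ℕ) : ℝ) + s + 1 := by positivity
        simp only
        rw [one_sub_div hp.ne']
        exact div_le_div_of_nonneg_right (by linarith) hp.le
      · intro n
        have h1 : (n : ℝ) ≤ 2 * ((n / 2 : ℕ) : ℝ) + 1 := by
          exact_mod_cast (by omega : n ≤ 2 * (n / 2) + 1)
        have hp : (0 : ℝ) < ((n / 2 : ℕ) : ℝ) + s + 1 := by positivity
        simp only
        rw [div_le_one hp]
        have : (0 : ℝ) ≤ s := by positivity
        linarith
    have hm := ih.mul hq
    rw [one_mul] at hm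
    refine hm.congr' ?_
    filter_upwards [eventually_ge_atTop (2 * s)] with n hn
    have hb : (n.choose (n / 2) : ℝ) ≠ 0 := by
      exact_mod_cast (Nat.choose_pos (Nat.div_le_self n 2)).ne'
    have hp : ((n / 2 : ℕ) : ℝ) + s + 1 ≠ 0 := by positivity
    have h := congrArg (Nat.cast (R := ℝ)) (Nat.choose_succ_right_eq n (n / 2 + s))
    rw [Nat.cast_mul, Nat.cast_mul, Nat.cast_sub (by omega : n / 2 + s ≤ n)] at h
    push_cast at h
    rw [← add_assoc]
    field_simp
    linarith

/-- The middle binomial coefficient at most doubles when the ground set grows by one element, so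
that the part of the first `k` coordinates costs no more than the factor `2 ^ k`. -/
theorem choose_add_middle_le (k m : ℕ) :
    (k + m).choose ((k + m) / 2) ≤ 2 ^ k * m.choose (m / 2) := by
  induction k with
  | zero => simp
  | succ k ih =>
    refine le_trans ?_ ((Nat.mul_le_mul_left 2 ih).trans_eq (by ring))
    rw [show k + 1 + m = (k + m) + 1 by ring]
    rcases Nat.eq_zero_or_pos ((k + m + 1) / 2) with h | h
    · rw [h, Nat.choose_zero_right]
      have := Nat.choose_pos (Nat.div_le_self (k + m) 2)
      omega
    · obtain ⟨j, hj⟩ := Nat.exists_eq_succ_of_ne_zero h.ne'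
      rw [hj, Nat.choose_succ_succ]
      have := Nat.choose_le_middle j (k + m)
      have := Nat.choose_le_middle j.succ (k + m)
      omega

/-! ### Joining sets on two blocks of coordinates -/

/-- The subset of `Fin (k + m)` whose traces on the first `k` and the last `m` elements are `T`
and `B`. -/
def join {k m : ℕ} (T : Finset (Fin k)) (B : Finset (Fin m)) : Finset (Fin (k + m)) :=
  (T.disjSum B).map finSumFinEquiv.toEmbedding

theorem join_subset_join {k m : ℕ} {T T' : Finset (Fin k)} {B B' : Finset (Fin m)} :
    join T B ⊆ join T' B' ↔ T ⊆ T' ∧ B ⊆ B' := by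
  rw [join, join, map_subset_map]
  refine ⟨fun h => ⟨?_, ?_⟩, fun h => disjSum_mono h.1 h.2⟩
  · exact fun x hx => inl_mem_disjSum.1 (h (inl_mem_disjSum.2 hx))
  · exact fun x hx => inr_mem_disjSum.1 (h (inr_mem_disjSum.2 hx))

theorem card_join {k m : ℕ} (T : Finset (Fin k)) (B : Finset (Fin m)) :
    (join T B).card = T.card + B.card := by
  rw [join, card_map, card_disjSum]

variable {P : Type*} [PartialOrder P]

theorem IsWeakEmbedding.of_subset_iff {n m : ℕ} {f : P → Finset (Fin n)}
    (hf : IsWeakEmbedding f) (e : Finset (Fin n) → Finset (Fin m))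
    (he : ∀ S T, e S ⊆ e T ↔ S ⊆ T) : IsWeakEmbedding fun p => e (f p) where
  injective p q h := hf.injective (((he _ _).1 h.subset).antisymm ((he _ _).1 h.symm.subset))
  ssubset_of_lt p q h := by
    have := hf.ssubset_of_lt p q h
    exact ⟨(he _ _).2 this.1, fun h' => this.2 ((he _ _).1 h')⟩

/-! ### A reversed linear extension that is constant on a convex family -/

open Classical in
/-- A height of the subsets of `Fin k` that decreases strictly along inclusion except that it is
constant on the family `Q`: sets above a member of `Q` get the values up to `k`, members of `Q` the
value `k + 1`, all others the values from `k + 2` on. -/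
noncomputable def height {k : ℕ} (Q : Finset (Finset (Fin k))) (T : Finset (Fin k)) : ℕ :=
  if T ∈ Q then k + 1 else if ∃ A ∈ Q, A ⊆ T then k - T.card else k + 2 + (k - T.card)

theorem height_of_mem {k : ℕ} {Q : Finset (Finset (Fin k))} {T : Finset (Fin k)} (h : T ∈ Q) :
    height Q T = k + 1 := if_pos h

theorem height_le {k : ℕ} (Q : Finset (Finset (Fin k))) (T : Finset (Fin k)) :
    height Q T ≤ 2 * k + 2 := by
  unfold height
  split_ifs <;> omega

theorem height_lt_height {k : ℕ} {Q : Finset (Finset (Fin k))}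
    (hQ : ∀ A ∈ Q, ∀ B ∈ Q, ∀ S, A ⊆ S → S ⊆ B → S ∈ Q) {T T' : Finset (Fin k)}
    (h : T ⊂ T') (hn : ¬ (T ∈ Q ∧ T' ∈ Q)) : height Q T' < height Q T := by
  have hc : T.card < T'.card := card_lt_card h
  have hc' : T'.card ≤ k := by simpa using T'.card_le_univ
  by_cases hT : T ∈ Q
  · have h1 : T' ∉ Q := fun h' => hn ⟨hT, h'⟩
    have h2 : ∃ A ∈ Q, A ⊆ T' := ⟨T, hT, h.subset⟩
    simp only [height, hT, h1, h2, if_true, if_false]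
    omega
  by_cases hU : ∃ A ∈ Q, A ⊆ T
  · obtain ⟨A, hA, hAT⟩ := hU
    have h1 : T' ∉ Q := fun h' => hT (hQ A hA T' h' T hAT h.subset)
    have h2 : ∃ A ∈ Q, A ⊆ T' := ⟨A, hA, hAT.trans h.subset⟩
    have h3 : ∃ A ∈ Q, A ⊆ T := ⟨A, hA, hAT⟩
    simp only [height, hT, h1, h2, h3, if_true, if_false]
    omega
  · simp only [height, hT, hU, if_false]
    split_ifs <;> omega

/-! ### The recursive construction -/

variable (P) in
/-- There are at least `x` pairwise unrelated weak embeddings of `P` into the subsets of `Fin n`,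
all of whose values have between `lo` and `hi` elements. -/
def HasPacking (n lo hi : ℕ) (x : ℝ) : Prop :=
  ∃ (ι : Type) (_ : Fintype ι) (g : ι → P → Finset (Fin n)),
    (∀ i, IsWeakEmbedding (g i)) ∧ (∀ i j, i ≠ j → ∀ p q, ¬ g i p ⊆ g j q) ∧
    (∀ i p, lo ≤ (g i p).card ∧ (g i p).card ≤ hi) ∧ x ≤ Fintype.card ι

theorem HasPacking.mono {n lo hi lo' hi' : ℕ} {x y : ℝ} (h : HasPacking P n lo hi x)
    (hlo : lo' ≤ lo) (hhi : hi ≤ hi') (hxy : y ≤ x) : HasPacking P n lo' hi' y := by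
  obtain ⟨ι, _, g, h1, h2, h3, h4⟩ := h
  exact ⟨ι, _, g, h1, h2, fun i p => ⟨hlo.trans (h3 i p).1, (h3 i p).2.trans hhi⟩, hxy.trans h4⟩

/-- Split the ground set into `k` and `m` elements. Each set of one fixed size on the last `m`
elements, joined to all the traces `f p`, gives one copy of `P`; above every trace outside the
convex closure of the image of `f` a packing on the last `m` elements is used. The sizes of the remainders lie in windows
ordered by `height`, which makes different parts unrelated. -/
theorem hasPacking_add [Fintype P] {k m s D : ℕ} {x : ℝ} {f : P → Finset (Fin k)}
    (hf : IsWeakEmbedding f)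
    (hx : ∀ j ≤ (D + 1) * (2 * k + 2), HasPacking P m (s + j) (s + j + D) x) :
    HasPacking P (k + m) s (k + (s + (D + 1) * (2 * k + 2) + D))
      ((2 ^ k - (convexClosure (univ.image f)).card) * x +
        m.choose (s + (D + 1) * (k + 1))) := by
  classical
  set Q := convexClosure (univ.image f) with hQdef
  have hQ : ∀ A ∈ Q, ∀ B ∈ Q, ∀ S, A ⊆ S → S ⊆ B → S ∈ Q := by
    intro A hA B hB S hAS hSB
    simp only [hQdef, convexClosure, mem_filter, mem_univ, true_and] at hA hB ⊢
    obtain ⟨A₀, hA₀, -, -, hA₁, -⟩ := hA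
    obtain ⟨-, -, B₀, hB₀, -, hB₁⟩ := hB
    exact ⟨A₀, hA₀, B₀, hB₀, hA₁.trans hAS, hSB.trans hB₁⟩
  have hfQ : ∀ p, f p ∈ Q := fun p =>
    subset_convexClosure _ (mem_image_of_mem f (mem_univ p))
  choose ι hι g hg hgu hgc hgx using fun T : {T // T ∉ Q} => hx ((D + 1) * height Q T)
    (Nat.mul_le_mul_left _ (height_le Q T))
  -- Inclusion between traces of different parts forces a drop in the size of the remainder.
  have key : ∀ {T T' : Finset (Fin k)} {B B' : Finset (Fin m)}, T ≠ T' → ¬ (T ∈ Q ∧ T' ∈ Q) →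
      s + (D + 1) * height Q T ≤ B.card → B'.card ≤ s + (D + 1) * height Q T' + D →
      ¬ join T B ⊆ join T' B' := by
    intro T T' B B' hne hn h1 h2 h
    rw [join_subset_join] at h
    have h3 := height_lt_height hQ (h.1.ssubset_of_ne hne) hn
    have h4 := card_le_card h.2
    have h5 := Nat.mul_le_mul_left (D + 1) (Nat.succ_le_of_lt h3)
    rw [Nat.mul_succ] at h5
    omega
  refine ⟨(Σ T : {T // T ∉ Q}, ι T) ⊕ {A : Finset (Fin m) // A.card = s + (D + 1) * (k + 1)},
    inferInstance, Sum.elim (fun i p => join i.1.1 (g i.1 i.2 p)) (fun A p => join (f p) A.1),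
    ?_, ?_, ?_, ?_⟩
  · rintro (⟨T, i⟩ | A)
    · exact (hg T i).of_subset_iff (fun B => join T.1 B) fun S S' => by simp [join_subset_join]
    · exact hf.of_subset_iff (fun B => join B A.1) fun S S' => by simp [join_subset_join]
  · rintro (⟨T, i⟩ | A) (⟨T', i'⟩ | A') hne p q
    · simp only [Sum.elim_inl]
      by_cases hT : T = T'
      · subst hT
        intro h
        exact hgu T i i' (fun h' => hne (by rw [h'])) p q (join_subset_join.1 h).2
      · exact key (fun h => hT (Subtype.ext h)) (fun h => T.2 h.1) (hgc T i p).1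
          (hgc T' i' q).2
    · simp only [Sum.elim_inl, Sum.elim_inr]
      refine key (fun h => T.2 (h ▸ hfQ q)) (fun h => T.2 h.1) (hgc T i p).1 ?_
      rw [height_of_mem (hfQ q), A'.2]
      omega
    · simp only [Sum.elim_inl, Sum.elim_inr]
      refine key (fun h => T'.2 (h ▸ hfQ p)) (fun h => T'.2 h.2) ?_ (hgc T' i' q).2
      rw [height_of_mem (hfQ p), A.2]
    · simp only [Sum.elim_inr]
      intro h
      refine hne (congrArg Sum.inr (Subtype.ext ?_))
      exact eq_of_subset_of_card_le (join_subset_join.1 h).2 (by rw [A.2, A'.2])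
  · have hh : ∀ T, (D + 1) * height Q T ≤ (D + 1) * (2 * k + 2) := fun T =>
      Nat.mul_le_mul_left _ (height_le Q T)
    have hk : ∀ T : Finset (Fin k), T.card ≤ k := fun T => by simpa using T.card_le_univ
    rintro (⟨T, i⟩ | A) p
    · simp only [Sum.elim_inl, card_join]
      have h1 := hgc T i p
      have h2 := hh T.1
      have h3 := hk T.1
      omega
    · simp only [Sum.elim_inr, card_join, A.2]
      have h2 := hh (f p)
      rw [height_of_mem (hfQ p)] at h2
      have h3 := hk (f p)
      omega
  · rw [Fintype.card_sum, Fintype.card_sigma, Fintype.card_finset_len, Fintype.card_fin]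
    push_cast
    have hcard : ((Fintype.card {T // T ∉ Q} : ℕ) : ℝ) = 2 ^ k - Q.card := by
      rw [Fintype.card_subtype_compl, Nat.cast_sub (Fintype.card_subtype_le _)]
      simp
    rw [← hcard]
    gcongr
    rw [← nsmul_eq_mul, ← card_univ (α := {T // T ∉ Q}), ← sum_const]
    exact sum_le_sum fun T _ => hgx T

variable (P) in
/-- The density `β`, relative to the size of the middle level, is asymptotically attained by
pairwise unrelated copies of `P` in a window of levels whose width `D` is fixed and which may start
at any fixed distance `s` above the middle. The freedom in `s` lets packings in disjoint windows be
combined. -/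
def AsymptoticPacking (β : ℝ) : Prop :=
  ∃ D : ℕ, ∀ s : ℕ, ∀ ε > 0, ∀ᶠ n : ℕ in atTop,
    HasPacking P n (n / 2 + s) (n / 2 + s + D) ((β - ε) * n.choose (n / 2))

theorem hasPacking_of_nonpos {n lo hi : ℕ} {x : ℝ} (hx : x ≤ 0) : HasPacking P n lo hi x :=
  ⟨Empty, inferInstance, fun i => i.elim, fun i => i.elim, fun i => i.elim, fun i => i.elim,
    by simpa using hx⟩

theorem asymptoticPacking_zero : AsymptoticPacking P 0 := by
  refine ⟨0, fun s ε hε => Eventually.of_forall fun n => hasPacking_of_nonpos ?_⟩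
  have : (0 : ℝ) ≤ ε * n.choose (n / 2) := by positivity
  linarith

variable [Fintype P]

theorem c_pos [Nonempty P] : 0 < c P := by
  obtain ⟨k, f, -, h⟩ := (c_isLeast P).1
  rw [← h, card_pos]
  exact ⟨_, subset_convexClosure _ (mem_image_of_mem f (mem_univ (Classical.arbitrary P)))⟩

/-- With `n = k + m`, each of the `2 ^ k - c P` traces outside the convex closure carries a packing
of relative density `β` and those inside it together carry one whole level, while the middle level
of `Fin m` has at least `2⁻¹ ^ k` times the size of that of `Fin n`. -/
theorem AsymptoticPacking.step [Nonempty P] {k : ℕ} {f : P → Finset (Fin k)}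
    (hf : IsWeakEmbedding f) (hc : (convexClosure (univ.image f)).card = c P) {β : ℝ}
    (h : AsymptoticPacking P β) :
    AsymptoticPacking P (((2 ^ k - c P) * β + 1) / 2 ^ k) := by
  obtain ⟨D, hD⟩ := h
  refine ⟨2 * k + (D + 1) * (2 * k + 2) + D, fun s ε hε => ?_⟩
  have h1 : ∀ᶠ m : ℕ in atTop, ∀ j ∈ range ((D + 1) * (2 * k + 2) + 1),
      HasPacking P m (m / 2 + (k + s + j)) (m / 2 + (k + s + j) + D)
        ((β - ε) * m.choose (m / 2)) :=
    (eventually_all_finset _).2 fun j _ => hD (k + s + j) ε hε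
  have h2 : ∀ᶠ m : ℕ in atTop, 1 - ε <
      (m.choose (m / 2 + (k + s + (D + 1) * (k + 1))) : ℝ) / m.choose (m / 2) :=
    (tendsto_choose_add_div_choose _).eventually (lt_mem_nhds (by linarith))
  rw [← map_add_atTop_eq_nat k, eventually_map]
  filter_upwards [h1, h2] with m h1 h2
  rw [add_comm m k]
  set β' : ℝ := ((2 ^ k - c P) * β + 1) / 2 ^ k with hβ'
  -- A negative density is attained by the empty packing and must be split off, since below the
  -- density is multiplied by an upper bound for the middle binomial coefficient.
  rcases le_total (β' - ε) 0 with hneg | hpos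
  · exact hasPacking_of_nonpos (mul_nonpos_of_nonpos_of_nonneg hneg (by positivity))
  have hb : (0 : ℝ) < m.choose (m / 2) := by
    exact_mod_cast Nat.choose_pos (Nat.div_le_self m 2)
  rw [lt_div_iff₀ hb] at h2
  refine (hasPacking_add (s := m / 2 + k + s) (D := D) (x := (β - ε) * m.choose (m / 2)) hf
    fun j hj => ?_).mono ?_ ?_ ?_
  · have := h1 j (mem_range.2 (by omega))
    rwa [show m / 2 + k + s + j = m / 2 + (k + s + j) by ring]
  · omega
  · have : m / 2 ≤ (k + m) / 2 := Nat.div_le_div_right (by omega)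
    omega
  · rw [hc, show m / 2 + k + s + (D + 1) * (k + 1) = m / 2 + (k + s + (D + 1) * (k + 1)) by ring]
    have h3 : ((k + m).choose ((k + m) / 2) : ℝ) ≤ 2 ^ k * m.choose (m / 2) := by
      exact_mod_cast choose_add_middle_le k m
    have h4 : (2 : ℝ) ^ k * β' = (2 ^ k - c P) * β + 1 := by
      rw [hβ']; field_simp
    -- The total error is `2 ^ k - c P + 1` times `ε`, at most `2 ^ k` times because `1 ≤ c P`.
    have hc1 : (1 : ℝ) ≤ c P := by exact_mod_cast c_pos (P := P)
    have h5 : 0 ≤ ((c P : ℝ) - 1) * ε * m.choose (m / 2) :=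
      mul_nonneg (mul_nonneg (by linarith) hε.le) hb.le
    calc (β' - ε) * ((k + m).choose ((k + m) / 2) : ℝ)
        ≤ (β' - ε) * (2 ^ k * m.choose (m / 2)) := by gcongr
      _ = (2 ^ k * β' - 2 ^ k * ε) * m.choose (m / 2) := by ring
      _ = ((2 ^ k - c P) * β + 1 - 2 ^ k * ε) * m.choose (m / 2) := by rw [h4]
      _ ≤ (2 ^ k - c P) * ((β - ε) * m.choose (m / 2)) + (1 - ε) * m.choose (m / 2) := by
        linarith
      _ ≤ _ := by gcongr

/-- Iterating the step from `0` approaches its fixed point `1 / c P` geometrically. -/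
theorem exists_asymptoticPacking [Nonempty P] {x : ℝ} (hx : x < 1 / c P) :
    ∃ β, x < β ∧ AsymptoticPacking P β := by
  obtain ⟨k, f, hf, hc⟩ := (c_isLeast P).1
  have hc0 : (0 : ℝ) < c P := by exact_mod_cast c_pos (P := P)
  have hck : (c P : ℝ) ≤ 2 ^ k := by
    have := card_le_univ (convexClosure (univ.image f))
    rw [hc, Fintype.card_finset, Fintype.card_fin] at this
    exact_mod_cast this
  set ρ : ℝ := (2 ^ k - c P) / 2 ^ k with hρ
  have h0 : 0 ≤ ρ := div_nonneg (by linarith) (by positivity)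
  have h1 : ρ < 1 := by
    rw [hρ, div_lt_one (by positivity)]
    linarith
  have hA : ∀ r : ℕ, AsymptoticPacking P ((1 - ρ ^ r) / c P) := by
    intro r
    induction r with
    | zero => simpa using asymptoticPacking_zero
    | succ r ih =>
      convert ih.step hf hc using 1
      have h2 : (2 : ℝ) ^ k * ρ = 2 ^ k - c P := by rw [hρ]; field_simp
      rw [← h2, pow_succ]
      have h3 : (c P : ℝ) = 2 ^ k * (1 - ρ) := by linarith
      have h4 : 1 - ρ ≠ 0 := by linarith
      rw [h3]
      field_simp
      ring
  have ht : Tendsto (fun r : ℕ => (1 - ρ ^ r) / c P) atTop (nhds (1 / c P)) := by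
    simpa using ((tendsto_pow_atTop_nhds_zero_of_lt_one h0 h1).const_sub 1).div_const (c P : ℝ)
  obtain ⟨r, hr⟩ := (ht.eventually (lt_mem_nhds hx)).exists
  exact ⟨_, hr, hA r⟩

theorem HasPacking.mul_card_le_pa [Nonempty P] {n lo hi : ℕ} {x : ℝ}
    (h : HasPacking P n lo hi x) : x * Fintype.card P ≤ pa n P := by
  classical
  obtain ⟨ι, _, g, hg, hu, -, hx⟩ := h
  have hun : ∀ i j, i ≠ j → Unrelated (univ.image (g i)) (univ.image (g j)) := by
    intro i j hij A hA B hB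
    simp only [mem_image, mem_univ, true_and] at hA hB
    obtain ⟨p, rfl⟩ := hA
    obtain ⟨q, rfl⟩ := hB
    exact ⟨hu i j hij p q, hu j i hij.symm q p⟩
  have hpack : IsPacking P (univ.biUnion fun i => univ.image (g i)) := by
    refine ⟨univ.image fun i => univ.image (g i), ?_, ?_, by simp [image_biUnion]⟩
    · simp only [mem_image, mem_univ, true_and]
      rintro _ ⟨i, rfl⟩
      exact ⟨g i, hg i, rfl⟩
    · simp only [mem_image, mem_univ, true_and]
      rintro _ ⟨i, rfl⟩ _ ⟨j, rfl⟩ hij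
      exact hun i j fun h => hij (by rw [h])
  have hcard : (univ.biUnion fun i => univ.image (g i)).card
      = Fintype.card ι * Fintype.card P := by
    rw [card_biUnion]
    · simp [card_image_of_injective _ (hg _).injective]
    · intro i _ j _ hij
      exact disjoint_left.2 fun A hA hA' => (hun i j hij A hA A hA').1 Subset.rfl
  have hle := (pa_isGreatest n P).2 ⟨_, hpack, rfl⟩
  rw [hcard] at hle
  calc x * Fintype.card P ≤ Fintype.card ι * Fintype.card P := by gcongr
    _ ≤ _ := by exact_mod_cast hle

/-! ### The asymptotics -/

theorem eventually_pa_div_le [Nonempty P] :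
    ∀ᶠ n : ℕ in atTop, (pa n P : ℝ) / n.choose (n / 2) ≤
      (Fintype.card P : ℝ) / c P * (n / (n - 4 * c P)) := by
  filter_upwards [eventually_ge_atTop (4 * c P + 2)] with n hn
  obtain ⟨m, hm, hm2⟩ := exists_pa_le (P := P) n
  have hb : (0 : ℝ) < n.choose (n / 2) := by
    exact_mod_cast Nat.choose_pos (Nat.div_le_self n 2)
  have hc0 : (0 : ℝ) < c P := by exact_mod_cast c_pos (P := P)
  have hn4 : (0 : ℝ) < (n : ℝ) - 4 * c P := by
    have : (4 * c P + 2 : ℝ) ≤ n := by exact_mod_cast hn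
    linarith
  have key : m * c P * ((n : ℝ) - 4 * c P) ≤ n * n.choose (n / 2) := by
    have hmn : m * c P * (n - 4 * c P) ≤ n * n.choose (n / 2) := by
      -- At most one copy obeys the bound too, because the middle level has at least `n` sets.
      rcases Nat.lt_or_ge m 2 with h | h
      · have hbn : n ≤ n.choose (n / 2) := by
          simpa using Nat.choose_le_middle 1 n
        calc m * c P * (n - 4 * c P) ≤ 1 * n * n :=
              Nat.mul_le_mul (Nat.mul_le_mul (by omega) (by omega)) (Nat.sub_le _ _)
          _ ≤ _ := by rw [one_mul]; gcongr
      · exact hm2 h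
    have := (Nat.cast_le (α := ℝ)).2 hmn
    push_cast [Nat.cast_sub (by omega : 4 * c P ≤ n)] at this
    exact this
  rw [div_le_iff₀ hb]
  calc (pa n P : ℝ) ≤ m * Fintype.card P := by exact_mod_cast hm
    _ ≤ ((n * n.choose (n / 2)) / (c P * ((n : ℝ) - 4 * c P))) * Fintype.card P := by
      gcongr
      rw [le_div_iff₀ (by positivity), ← mul_assoc]
      exact key
    _ = _ := by field_simp

theorem tendsto_pa_div_choose [Nonempty P] :
    Tendsto (fun n : ℕ => (pa n P : ℝ) / n.choose (n / 2)) atTop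
      (nhds ((Fintype.card P : ℝ) / c P)) := by
  have hP : (0 : ℝ) < Fintype.card P := by exact_mod_cast Fintype.card_pos
  refine tendsto_order.2 ⟨fun a ha => ?_, fun a ha => ?_⟩
  · have hx : a / Fintype.card P < 1 / c P := by
      rw [div_lt_iff₀ hP]
      calc a < _ := ha
        _ = _ := by ring
    obtain ⟨β, hβ, D, hD⟩ := exists_asymptoticPacking hx
    obtain ⟨y, hy, hy'⟩ := exists_between hβ
    filter_upwards [hD 0 (β - y) (by linarith)] with n hn
    have hb : (0 : ℝ) < n.choose (n / 2) := by
      exact_mod_cast Nat.choose_pos (Nat.div_le_self n 2)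
    have h1 := hn.mul_card_le_pa
    rw [div_lt_iff₀ hP] at hy
    rw [lt_div_iff₀ hb]
    calc a * n.choose (n / 2) < y * Fintype.card P * n.choose (n / 2) := by gcongr
      _ = _ := by ring
      _ ≤ _ := h1
  · have ht : Tendsto (fun n : ℕ => (Fintype.card P : ℝ) / c P * (n / (n - 4 * c P))) atTop
        (nhds ((Fintype.card P : ℝ) / c P)) := by
      have := (tendsto_natCast_div_add_atTop (-(4 * c P : ℝ))).const_mul
        ((Fintype.card P : ℝ) / c P)
      simpa [sub_eq_add_neg] using this
    filter_upwards [eventually_pa_div_le (P := P), ht.eventually (gt_mem_nhds ha)] with n h1 h2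
    exact h1.trans_lt h2

end PosetPacking

theorem theorem1p3 (P : Type*) [PartialOrder P] [Fintype P] [Nonempty P] :
    (fun n : ℕ => (PosetPacking.pa n P : ℝ)) ~[atTop]
      (fun n : ℕ => (Fintype.card P : ℝ) / (PosetPacking.c P : ℝ) * (n.choose (n / 2) : ℝ)) := by
  have hL : (Fintype.card P : ℝ) / PosetPacking.c P ≠ 0 :=
    div_ne_zero (by exact_mod_cast Fintype.card_ne_zero)
      (by exact_mod_cast (PosetPacking.c_pos (P := P)).ne')
  refine isEquivalent_of_tendsto_one ?_
  have h := (PosetPacking.tendsto_pa_div_choose (P := P)).div_const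
    ((Fintype.card P : ℝ) / PosetPacking.c P)
  rw [div_self hL] at h
  refine h.congr fun n => ?_
  rw [Pi.div_apply, div_div, mul_comm]
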